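/- Let $(X,d,\mu)$ be a complete metric space with a Borel measure $\mu$ that is doubling, i.e. there is $C_d>1$ such that $0<\mu(B(x,2r))\le C_d\,\mu(B(x,r))<\infty$ for all $x\in X$, $r>0$, where $B(x,r)$ denotes the open ball. Assume that $X$ satisfies an annular decay property: there are $0\le\alpha\le 1$ and $C\ge 1$ such that $$\mu\big(B(x,r)\setminus B(x,(1-\delta)r)\big)\le C\,\delta^{\alpha}\,\mu(B(x,r))$$ for all $x\in X$, $r>0$ and $0<\delta<1$. Write $f_B=\mu(B)^{-1}\int_B f\,d\mu$ for the average of $f$ over a ball $B$. Let $A_\infty(X)$ be the class of locally integrable functions $w$ that are positive almost everywhere, with $\log w$ integrable on every ball, such that $$\sup_{B} w_B\,\exp\big(-(\log w)_B\big)<\infty,$$ and let $RH_\infty(X)$ be the class of nonnegative locally integrable functions $w$ for which there is a constant $C<\infty$ such that $\operatorname{ess\,sup}_{B}w\le C\,w_B$ for every ball $B$ (the supremum and the condition ranging over all open balls of positive radius). A function $\varphi$ is called a multiplier of $RH_\infty(X)$ if $\varphi w\in RH_\infty(X)$ for every $w\in RH_\infty(X)$. Then a function $\varphi\in A_\infty(X)$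 is a multiplier of $RH_\infty(X)$ if and only if $\varphi\in RH_\infty(X)$. -/

import Mathlib

open MeasureTheory Metric

noncomputable section

variable {X : Type*} [MetricSpace X] [MeasurableSpace X]

/-- `μ` is doubling: there is `C_d > 1` with `0 < μ (2B) ≤ C_d μ(B) < ∞` for all open balls `B`. -/
def IsDoubling (μ : Measure X) : Prop :=
  ∃ Cd : ℝ, 1 < Cd ∧ ∀ (x : X) (r : ℝ), 0 < r →
    0 < μ (ball x (2 * r)) ∧
    μ (ball x (2 * r)) ≤ ENNReal.ofReal Cd * μ (ball x r) ∧
    ENNReal.ofReal Cd * μ (ball x r) < ⊤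

/-- The `α`-annular decay property. -/
def AnnularDecay (μ : Measure X) (α : ℝ) : Prop :=
  ∃ C : ℝ, 1 ≤ C ∧ ∀ (x : X) (r δ : ℝ), 0 < r → 0 < δ → δ < 1 →
    μ (ball x r \ ball x ((1 - δ) * r)) ≤ ENNReal.ofReal (C * δ ^ α) * μ (ball x r)

/-- An annular decay property: `α`-annular decay for some `0 ≤ α ≤ 1`. -/
def HasAnnularDecay (μ : Measure X) : Prop :=
  ∃ α : ℝ, 0 ≤ α ∧ α ≤ 1 ∧ AnnularDecay μ α

/-- The class `A_∞`, given by the reverse Jensen inequality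
`sup_B (⨍_B w) exp (-⨍_B log w) < ∞`.
Finiteness of the supremum means that `⨍_B log w` is never `-∞`; since `Real.log 0 = 0` and the
integral of a non-integrable function is `0` in Mathlib, this is spelled out as positivity a.e.
and integrability of `log w` on balls (`log⁺ w ≤ w` is always integrable there). -/
structure MemAInfty (μ : Measure X) (w : X → ℝ) : Prop where
  locallyIntegrable : LocallyIntegrable w μ
  pos : ∀ᵐ x ∂μ, 0 < w x
  log_integrableOn : ∀ (x : X) (r : ℝ), 0 < r →
    IntegrableOn (fun y => Real.log (w y)) (ball x r) μ
  reverse_jensen : ∃ C : ℝ, ∀ (x : X) (r : ℝ), 0 < r →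
    (⨍ y in ball x r, w y ∂μ) * Real.exp (-⨍ y in ball x r, Real.log (w y) ∂μ) ≤ C

/-- The class `RH_∞`: `esssup_B w ≤ C ⨍_B w` for all balls `B`. The essential supremum is taken
in `[0, ∞]`, so that it is `∞` for essentially unbounded functions. -/
structure MemRHInfty (μ : Measure X) (w : X → ℝ) : Prop where
  locallyIntegrable : LocallyIntegrable w μ
  nonneg : ∀ᵐ x ∂μ, 0 ≤ w x
  reverse_holder : ∃ C : ℝ, ∀ (x : X) (r : ℝ), 0 < r →
    essSup (fun y => ENNReal.ofReal (w y)) (μ.restrict (ball x r)) ≤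
      ENNReal.ofReal (C * ⨍ y in ball x r, w y ∂μ)

/-- `φ` is a multiplier of `RH_∞`: `φ w ∈ RH_∞` for all `w ∈ RH_∞`. -/
def IsMultiplierRHInfty (μ : Measure X) (φ : X → ℝ) : Prop :=
  ∀ w : X → ℝ, MemRHInfty μ w → MemRHInfty μ (fun x => φ x * w x)

end

/-!
Only the implication from `RH_∞` to multipliers has content. Let `P` be the normalized measure on a
ball `B` and `m = φ_B`. The function `φ / m - 1 - log (φ / m)` is nonnegative and its mean is
`log φ_B - (log φ)_B`, the Jensen deficit that `A_∞` bounds uniformly in `B`. If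
`0 ≤ w ≤ K w_B`, the mean of this function for the weight `w / w_B` is therefore at most `K` times
the deficit, and Jensen's inequality for that weight gives `φ_B w_B ≤ C' (φ w)_B`. Multiplying the
essential bounds `φ ≤ L φ_B` and `w ≤ K w_B` then yields `φ w ≤ L K C' (φ w)_B` on `B`.
-/

section Measure

variable {Ω : Type*} [MeasurableSpace Ω] {μ P : Measure Ω} {f w φ : Ω → ℝ}

theorem essSup_ofReal_le_ofReal_iff {c : ℝ} (hc : 0 ≤ c) :
    essSup (fun x => ENNReal.ofReal (f x)) μ ≤ ENNReal.ofReal c ↔ ∀ᵐ x ∂μ, f x ≤ c := by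
  refine ⟨fun h => ?_, fun h => essSup_le_of_ae_le _ (h.mono fun x => ENNReal.ofReal_le_ofReal)⟩
  filter_upwards [ENNReal.ae_le_essSup fun x => ENNReal.ofReal (f x)] with x hx
  exact (ENNReal.ofReal_le_ofReal_iff hc).1 (hx.trans h)

theorem average_nonneg_of_ae (hf : ∀ᵐ x ∂μ, 0 ≤ f x) : 0 ≤ ⨍ x, f x ∂μ :=
  integral_nonneg_of_ae (Measure.ae_smul_measure hf _)

theorem integral_pos_of_ae_pos [NeZero μ] (hf : Integrable f μ) (hf_pos : ∀ᵐ x ∂μ, 0 < f x) :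
    0 < ∫ x, f x ∂μ := by
  have hf_nonneg : 0 ≤ᵐ[μ] f := hf_pos.mono fun x => le_of_lt
  refine (integral_nonneg_of_ae hf_nonneg).lt_of_ne' fun hzero => ?_
  have hf_zero := (integral_eq_zero_iff_of_nonneg_ae hf_nonneg hf).1 hzero
  obtain ⟨x, hx_pos, hx_zero⟩ := (hf_pos.and hf_zero).exists
  exact hx_pos.ne' hx_zero

theorem integrable_mul_of_ae_nonneg_of_ae_le {M : ℝ} (hf : Integrable f μ)
    (hw : AEStronglyMeasurable w μ) (hw_nonneg : ∀ᵐ x ∂μ, 0 ≤ w x) (hw_le : ∀ᵐ x ∂μ, w x ≤ M) :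
    Integrable (fun x => f x * w x) μ := by
  refine hf.mul_bdd (c := M) hw ?_
  filter_upwards [hw_nonneg, hw_le] with x hx_nonneg hx_le
  rwa [Real.norm_of_nonneg hx_nonneg]

-- Jensen's inequality for the weight `w`: integrate the tangent line of `exp` at `t`.
theorem exp_mul_integral_le_integral_exp_mul {t : ℝ} (hw : Integrable w μ)
    (hw_nonneg : ∀ᵐ x ∂μ, 0 ≤ w x) (hfw : Integrable (fun x => f x * w x) μ)
    (hexp : Integrable (fun x => Real.exp (f x) * w x) μ)
    (ht : t * ∫ x, w x ∂μ ≤ ∫ x, f x * w x ∂μ) :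
    Real.exp t * ∫ x, w x ∂μ ≤ ∫ x, Real.exp (f x) * w x ∂μ := by
  have tangent (y : ℝ) : Real.exp t * (1 - t + y) ≤ Real.exp y := by
    calc Real.exp t * (1 - t + y)
        ≤ Real.exp t * Real.exp (y - t) := by
          gcongr
          linarith [Real.add_one_le_exp (y - t)]
      _ = Real.exp y := by rw [← Real.exp_add, add_sub_cancel]
  calc Real.exp t * ∫ x, w x ∂μ
      ≤ Real.exp t * ((1 - t) * ∫ x, w x ∂μ + ∫ x, f x * w x ∂μ) := by
        gcongr
        linarith
    _ = ∫ x, Real.exp t * ((1 - t) * w x + f x * w x) ∂μ := by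
        rw [integral_const_mul, integral_add (hw.const_mul _) hfw, integral_const_mul]
    _ ≤ ∫ x, Real.exp (f x) * w x ∂μ := by
        refine integral_mono_ae (((hw.const_mul _).add hfw).const_mul _) hexp ?_
        filter_upwards [hw_nonneg] with x hx
        calc Real.exp t * ((1 - t) * w x + f x * w x)
            = Real.exp t * (1 - t + f x) * w x := by ring
          _ ≤ Real.exp (f x) * w x := by gcongr; exact tangent (f x)

theorem integrable_log_div_const [IsFiniteMeasure μ] {c : ℝ} (hc : c ≠ 0)
    (hφ_pos : ∀ᵐ x ∂μ, 0 < φ x) (hlog : Integrable (fun x => Real.log (φ x)) μ) :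
    Integrable (fun x => Real.log (φ x / c)) μ := by
  refine (hlog.sub (integrable_const (Real.log c))).congr ?_
  filter_upwards [hφ_pos] with x hx
  exact (Real.log_div hx.ne' hc).symm

variable [IsProbabilityMeasure P]

theorem integral_div_sub_one_sub_log_div (hφ : Integrable φ P) (hφ_pos : ∀ᵐ x ∂P, 0 < φ x)
    (hlog : Integrable (fun x => Real.log (φ x)) P) :
    ∫ x, (φ x / (∫ y, φ y ∂P) - 1 - Real.log (φ x / ∫ y, φ y ∂P)) ∂P =
      Real.log (∫ x, φ x ∂P) - ∫ x, Real.log (φ x) ∂P := by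
  have hm_pos := integral_pos_of_ae_pos hφ hφ_pos
  set m := ∫ x, φ x ∂P with hm
  have hlog_div : ∫ x, Real.log (φ x / m) ∂P = ∫ x, Real.log (φ x) ∂P - Real.log m := by
    calc ∫ x, Real.log (φ x / m) ∂P
        = ∫ x, (Real.log (φ x) - Real.log m) ∂P :=
          integral_congr_ae (hφ_pos.mono fun x hx => Real.log_div hx.ne' hm_pos.ne')
      _ = ∫ x, Real.log (φ x) ∂P - Real.log m := by
          rw [integral_sub hlog (integrable_const _), integral_const, probReal_univ, one_smul]
  have hdiv_sub_one : ∫ x, (φ x / m - 1) ∂P = 0 := by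
    rw [integral_sub (hφ.div_const m) (integrable_const 1), integral_div, ← hm,
      div_self hm_pos.ne', integral_const, probReal_univ, one_smul, sub_self]
  have hdiv_int : Integrable (fun x => φ x / m - 1) P :=
    (hφ.div_const m).sub (integrable_const 1)
  rw [integral_sub hdiv_int (integrable_log_div_const hm_pos.ne' hφ_pos hlog), hdiv_sub_one,
    hlog_div, zero_sub, neg_sub]

theorem neg_integral_add_mul_le_integral_log_div_mul {M : ℝ} (hφ : Integrable φ P)
    (hφ_pos : ∀ᵐ x ∂P, 0 < φ x) (hlog : Integrable (fun x => Real.log (φ x)) P)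
    (hw : Integrable w P) (hw_nonneg : ∀ᵐ x ∂P, 0 ≤ w x) (hw_le : ∀ᵐ x ∂P, w x ≤ M) :
    -(∫ x, w x ∂P + M * (Real.log (∫ x, φ x ∂P) - ∫ x, Real.log (φ x) ∂P)) ≤
      ∫ x, Real.log (φ x / ∫ y, φ y ∂P) * w x ∂P := by
  rw [← integral_div_sub_one_sub_log_div hφ hφ_pos hlog]
  have hm_pos := integral_pos_of_ae_pos hφ hφ_pos
  set m := ∫ x, φ x ∂P
  have hlog_div := integrable_log_div_const hm_pos.ne' hφ_pos hlog
  have hdeficit : Integrable (fun x => φ x / m - 1 - Real.log (φ x / m)) P :=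
    ((hφ.div_const m).sub (integrable_const 1)).sub hlog_div
  have hlog_mul : Integrable (fun x => Real.log (φ x / m) * w x) P :=
    integrable_mul_of_ae_nonneg_of_ae_le hlog_div hw.aestronglyMeasurable hw_nonneg hw_le
  rw [← integral_const_mul, ← integral_add hw (hdeficit.const_mul M), ← integral_neg]
  refine integral_mono_ae (hw.add (hdeficit.const_mul M)).neg hlog_mul ?_
  filter_upwards [hφ_pos, hw_nonneg, hw_le] with x hφx hwx_nonneg hwx_le
  have hratio : 0 < φ x / m := div_pos hφx hm_pos
  have hdeficit_nonneg : 0 ≤ φ x / m - 1 - Real.log (φ x / m) :=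
    sub_nonneg.2 (Real.log_le_sub_one_of_pos hratio)
  calc -(w x + M * (φ x / m - 1 - Real.log (φ x / m)))
      ≤ -(w x + w x * (φ x / m - 1 - Real.log (φ x / m))) := by gcongr
    _ ≤ φ x / m * w x - (w x + w x * (φ x / m - 1 - Real.log (φ x / m))) := by
        linarith [mul_nonneg hratio.le hwx_nonneg]
    _ = Real.log (φ x / m) * w x := by ring

theorem integral_mul_integral_le_exp_mul_integral_mul {K : ℝ} (hφ : Integrable φ P)
    (hφ_pos : ∀ᵐ x ∂P, 0 < φ x) (hlog : Integrable (fun x => Real.log (φ x)) P)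
    (hw : Integrable w P) (hw_nonneg : ∀ᵐ x ∂P, 0 ≤ w x)
    (hw_le : ∀ᵐ x ∂P, w x ≤ K * ∫ y, w y ∂P) :
    (∫ x, φ x ∂P) * ∫ x, w x ∂P ≤
      Real.exp (1 + K * (Real.log (∫ x, φ x ∂P) - ∫ x, Real.log (φ x) ∂P)) *
        ∫ x, φ x * w x ∂P := by
  have hlog_mean := neg_integral_add_mul_le_integral_log_div_mul hφ hφ_pos hlog hw hw_nonneg hw_le
  have hm_pos := integral_pos_of_ae_pos hφ hφ_pos
  set m := ∫ x, φ x ∂P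
  set v := ∫ x, w x ∂P
  set t := 1 + K * (Real.log m - ∫ x, Real.log (φ x) ∂P) with ht
  have integrable_mul {f : Ω → ℝ} (hf : Integrable f P) : Integrable (fun x => f x * w x) P :=
    integrable_mul_of_ae_nonneg_of_ae_le hf hw.aestronglyMeasurable hw_nonneg hw_le
  have hexp_log : (fun x => Real.exp (Real.log (φ x / m)) * w x) =ᵐ[P]
      fun x => φ x * w x / m := by
    filter_upwards [hφ_pos] with x hx
    rw [Real.exp_log (div_pos hx hm_pos), div_mul_eq_mul_div]
  have hjensen : Real.exp (-t) * v ≤ (∫ x, φ x * w x ∂P) / m := by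
    rw [← integral_div, ← integral_congr_ae hexp_log]
    refine exp_mul_integral_le_integral_exp_mul hw hw_nonneg
      (integrable_mul (integrable_log_div_const hm_pos.ne' hφ_pos hlog))
      (((integrable_mul hφ).div_const m).congr hexp_log.symm)
      (le_trans (le_of_eq ?_) hlog_mean)
    rw [ht]
    ring
  rw [le_div_iff₀ hm_pos] at hjensen
  calc m * v = Real.exp t * (Real.exp (-t) * v * m) := by rw [Real.exp_neg]; field_simp
    _ ≤ Real.exp t * ∫ x, φ x * w x ∂P := by gcongr

theorem average_mul_average_le_exp_mul_average_mul [IsFiniteMeasure μ] [NeZero μ] {C K : ℝ}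
    (hφ : Integrable φ μ) (hφ_pos : ∀ᵐ x ∂μ, 0 < φ x)
    (hlog : Integrable (fun x => Real.log (φ x)) μ)
    (hC : (⨍ x, φ x ∂μ) * Real.exp (-⨍ x, Real.log (φ x) ∂μ) ≤ C)
    (hw : Integrable w μ) (hw_nonneg : ∀ᵐ x ∂μ, 0 ≤ w x) (hK : 0 ≤ K)
    (hw_le : ∀ᵐ x ∂μ, w x ≤ K * ⨍ y, w y ∂μ) :
    (⨍ x, φ x ∂μ) * ⨍ x, w x ∂μ ≤
      Real.exp (1 + K * Real.log C) * ⨍ x, φ x * w x ∂μ := by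
  have hm_pos : 0 < ⨍ x, φ x ∂μ :=
    integral_pos_of_ae_pos hφ.to_average (Measure.ae_smul_measure hφ_pos _)
  have hdeficit : Real.log (⨍ x, φ x ∂μ) - ⨍ x, Real.log (φ x) ∂μ ≤ Real.log C := by
    have hlog_le := Real.log_le_log (mul_pos hm_pos (Real.exp_pos _)) hC
    rwa [Real.log_mul hm_pos.ne' (Real.exp_ne_zero _), Real.log_exp, ← sub_eq_add_neg] at hlog_le
  have hφw_nonneg : 0 ≤ ⨍ x, φ x * w x ∂μ := by
    refine average_nonneg_of_ae ?_
    filter_upwards [hφ_pos, hw_nonneg] with x hφx hwx using mul_nonneg hφx.le hwx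
  calc (⨍ x, φ x ∂μ) * ⨍ x, w x ∂μ
      ≤ Real.exp (1 + K * (Real.log (⨍ x, φ x ∂μ) - ⨍ x, Real.log (φ x) ∂μ)) *
          ⨍ x, φ x * w x ∂μ :=
        integral_mul_integral_le_exp_mul_integral_mul hφ.to_average
          (Measure.ae_smul_measure hφ_pos _) hlog.to_average hw.to_average
          (Measure.ae_smul_measure hw_nonneg _) (Measure.ae_smul_measure hw_le _)
    _ ≤ Real.exp (1 + K * Real.log C) * ⨍ x, φ x * w x ∂μ := by gcongr

end Measure

section Ball

variable {X : Type*} [MetricSpace X] [MeasurableSpace X] {μ : Measure X} {w φ : X → ℝ}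

theorem IsDoubling.measure_ball_pos (hμ : IsDoubling μ) (x : X) (r : ℝ) (hr : 0 < r) :
    0 < μ (ball x r) := by
  obtain ⟨Cd, -, hball⟩ := hμ
  simpa only [mul_div_cancel₀ r two_ne_zero] using (hball x (r / 2) (half_pos hr)).1

theorem IsDoubling.measure_ball_lt_top (hμ : IsDoubling μ) (x : X) (r : ℝ) (hr : 0 < r) :
    μ (ball x r) < ⊤ := by
  obtain ⟨Cd, hCd, hball⟩ := hμ
  exact ENNReal.lt_top_of_mul_ne_top_right (hball x r hr).2.2.ne
    (ENNReal.ofReal_pos.2 (zero_lt_one.trans hCd)).ne'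

theorem MemRHInfty.exists_ae_le (hw : MemRHInfty μ w) : ∃ K : ℝ, 0 ≤ K ∧ ∀ (x : X) (r : ℝ),
    0 < r → ∀ᵐ y ∂μ.restrict (ball x r), w y ≤ K * ⨍ z in ball x r, w z ∂μ := by
  obtain ⟨C, hC⟩ := hw.reverse_holder
  refine ⟨max C 0, le_max_right _ _, fun x r hr => ?_⟩
  have havg : 0 ≤ ⨍ z in ball x r, w z ∂μ := average_nonneg_of_ae (ae_restrict_of_ae hw.nonneg)
  refine (essSup_ofReal_le_ofReal_iff (by positivity)).1 ((hC x r hr).trans ?_)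
  gcongr
  exact le_max_left _ _

-- If `w` were not integrable on the ball, its average there would be the default value `0`, and
-- the reverse Hölder inequality would force `w = 0` almost everywhere on the ball.
theorem MemRHInfty.integrableOn_ball (hw : MemRHInfty μ w) (x : X) (r : ℝ) (hr : 0 < r) :
    IntegrableOn w (ball x r) μ := by
  by_contra hw_int
  obtain ⟨K, -, hK⟩ := hw.exists_ae_le
  have havg : ⨍ z in ball x r, w z ∂μ = 0 := by
    rw [setAverage_eq, integral_undef hw_int, smul_zero]
  have hw_zero : 0 =ᵐ[μ.restrict (ball x r)] w := by
    filter_upwards [hK x r hr, ae_restrict_of_ae hw.nonneg] with y hy_le hy_nonneg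
    rw [havg, mul_zero] at hy_le
    exact le_antisymm hy_nonneg hy_le
  exact hw_int ((integrable_zero X ℝ _).congr hw_zero)

theorem MemRHInfty.of_ae_le {K : ℝ} (hK : 0 ≤ K)
    (hw_int : ∀ (x : X) (r : ℝ), 0 < r → IntegrableOn w (ball x r) μ)
    (hw_nonneg : ∀ᵐ x ∂μ, 0 ≤ w x)
    (hw_le : ∀ (x : X) (r : ℝ), 0 < r →
      ∀ᵐ y ∂μ.restrict (ball x r), w y ≤ K * ⨍ z in ball x r, w z ∂μ) :
    MemRHInfty μ w where
  locallyIntegrable x := ⟨ball x 1, ball_mem_nhds x one_pos, hw_int x 1 one_pos⟩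
  nonneg := hw_nonneg
  reverse_holder := ⟨K, fun x r hr => (essSup_ofReal_le_ofReal_iff
    (mul_nonneg hK (average_nonneg_of_ae (ae_restrict_of_ae hw_nonneg)))).2 (hw_le x r hr)⟩

theorem MemRHInfty.integrableOn_mul_ball (hφ : MemRHInfty μ φ) (hw : MemRHInfty μ w) (x : X)
    (r : ℝ) (hr : 0 < r) : IntegrableOn (fun y => φ y * w y) (ball x r) μ := by
  obtain ⟨K, -, hK⟩ := hw.exists_ae_le
  exact integrable_mul_of_ae_nonneg_of_ae_le (hφ.integrableOn_ball x r hr)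
    (hw.integrableOn_ball x r hr).aestronglyMeasurable (ae_restrict_of_ae hw.nonneg) (hK x r hr)

theorem memRHInfty_one (hpos : ∀ (x : X) (r : ℝ), 0 < r → 0 < μ (ball x r))
    (hfin : ∀ (x : X) (r : ℝ), 0 < r → μ (ball x r) < ⊤) : MemRHInfty μ (fun _ => 1) := by
  refine .of_ae_le zero_le_one (fun x r hr => integrableOn_const (hfin x r hr).ne)
    (.of_forall fun _ => zero_le_one) fun x r hr => .of_forall fun _ => ?_
  rw [setAverage_const (hpos x r hr).ne' (hfin x r hr).ne, one_mul]

theorem MemAInfty.exists_average_mul_average_le (hφA : MemAInfty μ φ) (hφ : MemRHInfty μ φ)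
    (hw : MemRHInfty μ w) (hpos : ∀ (x : X) (r : ℝ), 0 < r → 0 < μ (ball x r))
    (hfin : ∀ (x : X) (r : ℝ), 0 < r → μ (ball x r) < ⊤) :
    ∃ M : ℝ, 0 ≤ M ∧ ∀ (x : X) (r : ℝ), 0 < r →
      (⨍ y in ball x r, φ y ∂μ) * ⨍ y in ball x r, w y ∂μ ≤
        M * ⨍ y in ball x r, φ y * w y ∂μ := by
  obtain ⟨C, hC⟩ := hφA.reverse_jensen
  obtain ⟨K, hK_nonneg, hK⟩ := hw.exists_ae_le
  refine ⟨Real.exp (1 + K * Real.log C), Real.exp_nonneg _, fun x r hr => ?_⟩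
  have : IsFiniteMeasure (μ.restrict (ball x r)) := isFiniteMeasure_restrict.2 (hfin x r hr).ne
  have : NeZero (μ.restrict (ball x r)) :=
    ⟨fun hzero => (hpos x r hr).ne' (Measure.restrict_eq_zero.1 hzero)⟩
  exact average_mul_average_le_exp_mul_average_mul (hφ.integrableOn_ball x r hr)
    (ae_restrict_of_ae hφA.pos) (hφA.log_integrableOn x r hr) (hC x r hr)
    (hw.integrableOn_ball x r hr) (ae_restrict_of_ae hw.nonneg) hK_nonneg (hK x r hr)

theorem MemRHInfty.mul (hφ : MemRHInfty μ φ) (hφA : MemAInfty μ φ) (hw : MemRHInfty μ w)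
    (hpos : ∀ (x : X) (r : ℝ), 0 < r → 0 < μ (ball x r))
    (hfin : ∀ (x : X) (r : ℝ), 0 < r → μ (ball x r) < ⊤) :
    MemRHInfty μ (fun x => φ x * w x) := by
  obtain ⟨L, hL_nonneg, hL⟩ := hφ.exists_ae_le
  obtain ⟨K, hK_nonneg, hK⟩ := hw.exists_ae_le
  obtain ⟨M, hM_nonneg, hM⟩ := hφA.exists_average_mul_average_le hφ hw hpos hfin
  have hφw_nonneg : ∀ᵐ x ∂μ, 0 ≤ φ x * w x := by
    filter_upwards [hφ.nonneg, hw.nonneg] with x hφx hwx using mul_nonneg hφx hwx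
  refine .of_ae_le (K := L * K * M) (by positivity) (hφ.integrableOn_mul_ball hw) hφw_nonneg
    fun x r hr => ?_
  filter_upwards [hL x r hr, hK x r hr, ae_restrict_of_ae hφ.nonneg,
    ae_restrict_of_ae hw.nonneg] with y hφy_le hwy_le hφy_nonneg hwy_nonneg
  calc φ y * w y
      ≤ (L * ⨍ z in ball x r, φ z ∂μ) * (K * ⨍ z in ball x r, w z ∂μ) :=
        mul_le_mul hφy_le hwy_le hwy_nonneg (hφy_nonneg.trans hφy_le)
    _ = L * K * ((⨍ z in ball x r, φ z ∂μ) * ⨍ z in ball x r, w z ∂μ) := by ring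
    _ ≤ L * K * (M * ⨍ z in ball x r, φ z * w z ∂μ) :=
        mul_le_mul_of_nonneg_left (hM x r hr) (mul_nonneg hL_nonneg hK_nonneg)
    _ = L * K * M * ⨍ z in ball x r, φ z * w z ∂μ := by ring

theorem mainTheorem6_general (hpos : ∀ (x : X) (r : ℝ), 0 < r → 0 < μ (ball x r))
    (hfin : ∀ (x : X) (r : ℝ), 0 < r → μ (ball x r) < ⊤) (hφ : MemAInfty μ φ) :
    IsMultiplierRHInfty μ φ ↔ MemRHInfty μ φ := by
  refine ⟨fun hmul => ?_, fun hφ_RH w hw => hφ_RH.mul hφ hw hpos hfin⟩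
  simpa only [mul_one] using hmul _ (memRHInfty_one hpos hfin)

end Ball

theorem mainTheorem6 {X : Type*} [MetricSpace X] [CompleteSpace X] [MeasurableSpace X]
    [BorelSpace X] (μ : Measure X) (hμ : IsDoubling μ) (hX : HasAnnularDecay μ)
    (φ : X → ℝ) (hφ : MemAInfty μ φ) :
    IsMultiplierRHInfty μ φ ↔ MemRHInfty μ φ :=
  mainTheorem6_general hμ.measure_ball_pos hμ.measure_ball_lt_top hφ
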